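/- Let $m$ be normalized Lebesgue measure on the unit circle $\mathbb T$, let $H^2\subset L^2(\mathbb T,m)$ be the Hardy space, and let $\theta$ be an inner function, that is, a bounded analytic function in the unit disk whose nontangential boundary values have modulus $1$ $m$-almost everywhere. Let $K_\theta=H^2\cap\theta\,\overline{zH^2}=H^2\ominus\theta H^2$. Put $$X=\Big\{\sum_k x_k\bar y_k:\ x_k,y_k\in K_\theta,\ \sum_k\|x_k\|_2\|y_k\|_2<\infty\Big\},\qquad X_a=\Big\{\sum_k x_ky_k:\ x_k,y_k\in K_\theta,\ \sum_k\|x_k\|_2\|y_k\|_2<\infty\Big\},$$ where the sums are finite or countable and converge in $L^1(\mathbb T,m)$. The norm of an element in each of these spaces is the infimum of $\sum_k\|x_k\|_2\|y_k\|_2$ over all its representations of the indicated form. Then: 1) Every element $f$ of $X$ with $f\ge 0$ $m$-a.e. can be written as $f=|g|^2$ with $g\in K_\theta$. 2) Every element of $X$ is a linear combination (with complex coefficients) of four nonnegative elements of $X$. 3) Every $f\in X$ can be written as $f=\sum_{k=1}^4 x_k\bar y_k$ with $x_k,y_k\in K_\theta$ and $\|x_k\bar y_k\|_X\le\|f\|_X$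 for $k=1,\dots,4$. Likewise, every $f\in X_a$ can be written as $f=\sum_{k=1}^4 x_ky_k$ with $x_k,y_k\in K_\theta$ and $\|x_ky_k\|_{X_a}\le\|f\|_{X_a}$ for $k=1,\dots,4$. -/

import Mathlib

open Filter MeasureTheory Topology
open scoped ComplexConjugate ENNReal ComplexOrder

noncomputable section

namespace ModelSpace

/-- Normalized Lebesgue measure on the unit circle. A point of the circle is written as
`z = exp (2 π i t)` with `t` in `ℝ / ℤ`. -/
abbrev m : Measure UnitAddCircle := AddCircle.haarAddCircle

/-- The space `L²(𝕋, m)`. -/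
abbrev L2 : Type := Lp ℂ 2 m

/-- The space `L¹(𝕋, m)`. -/
abbrev L1 : Type := Lp ℂ 1 m

/-- The coordinate function `z` on the circle: `z t = exp (2 π i t)`. -/
def z (t : UnitAddCircle) : ℂ := (AddCircle.toCircle t : ℂ)

/-- The Stolz (nontangential approach) region of aperture `M` at the boundary point `ζ`. -/
def stolz (ζ : ℂ) (M : ℝ) : Set ℂ := {w | ‖w‖ < 1 ∧ ‖ζ - w‖ < M * (1 - ‖w‖)}

/-- The filter of nontangential approach to `ζ` from inside the unit disk: convergence along it
means convergence within every Stolz region at `ζ`. -/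
def nontangential (ζ : ℂ) : Filter ℂ := ⨆ M : ℝ, 𝓝[stolz ζ M] ζ

/-- Inner functions: analytic and bounded in the unit disk, with nontangential boundary values
of modulus one almost everywhere. Only the values of `θ` in the open disk matter. -/
structure IsInner (θ : ℂ → ℂ) : Prop where
  analytic : DifferentiableOn ℂ θ (Metric.ball 0 1)
  bounded : ∃ C : ℝ, ∀ w ∈ Metric.ball (0 : ℂ) 1, ‖θ w‖ ≤ C
  unimodular : ∀ᵐ t ∂m, ∃ b : ℂ, ‖b‖ = 1 ∧ Tendsto θ (nontangential (z t)) (𝓝 b)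

/-- The nontangential boundary function on the circle of a function in the disk. -/
def boundary (θ : ℂ → ℂ) (t : UnitAddCircle) : ℂ := limUnder (nontangential (z t)) θ

/-- The Hardy space `H²`, as a space of boundary functions on the circle: the functions in `L²`
whose Fourier coefficients of negative index vanish. -/
def hardy2 : Submodule ℂ L2 where
  carrier := {f | ∀ n : ℤ, n < 0 → fourierCoeff (f : UnitAddCircle → ℂ) n = 0}
  zero_mem' := by
    intro n _
    rw [fourierCoeff_congr_ae (Lp.coeFn_zero ℂ 2 m)]
    simp [fourierCoeff]
  add_mem' := by
    intro f g hf hg n hn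
    rw [fourierCoeff_congr_ae (Lp.coeFn_add f g),
      fourierCoeff.add ((Lp.memLp f).integrable (by norm_num))
        ((Lp.memLp g).integrable (by norm_num))]
    simp [hf n hn, hg n hn]
  smul_mem' := by
    intro c f hf n hn
    rw [fourierCoeff_congr_ae (Lp.coeFn_smul c f), fourierCoeff.const_smul, hf n hn, smul_zero]

/-- The model space `K_θ = H² ∩ θ H²₋`, where `H²₋` consists of the complex conjugates of the
functions `z g` with `g ∈ H²`. -/
def K (θ : ℂ → ℂ) : Submodule ℂ L2 where
  carrier := {f | f ∈ hardy2 ∧ ∃ g ∈ hardy2, ∀ᵐ t ∂m, f t = boundary θ t * conj (z t * g t)}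
  zero_mem' := by
    refine ⟨hardy2.zero_mem, 0, hardy2.zero_mem, ?_⟩
    filter_upwards with t
    simp
  add_mem' := by
    rintro f₁ f₂ ⟨h₁, g₁, hg₁, e₁⟩ ⟨h₂, g₂, hg₂, e₂⟩
    refine ⟨hardy2.add_mem h₁ h₂, g₁ + g₂, hardy2.add_mem hg₁ hg₂, ?_⟩
    filter_upwards [e₁, e₂, Lp.coeFn_add f₁ f₂, Lp.coeFn_add g₁ g₂] with t a b hf hg
    simp only [hf, hg, Pi.add_apply, a, b, map_mul, map_add]
    ring
  smul_mem' := by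
    rintro c f ⟨h, g, hg, e⟩
    refine ⟨hardy2.smul_mem c h, conj c • g, hardy2.smul_mem _ hg, ?_⟩
    filter_upwards [e, Lp.coeFn_smul c f, Lp.coeFn_smul (conj c) g] with t a hf hg
    simp only [hf, hg, Pi.smul_apply, a, map_mul, smul_eq_mul, Complex.conj_conj]
    ring

/-- The product `x y` of two `L²` functions, as an element of `L¹`. -/
def mul (x y : L2) : L1 :=
  MemLp.toLp (fun t => x t * y t) (MemLp.mul (r := 1) (Lp.memLp y) (Lp.memLp x))

/-- The product of `x` with the complex conjugate of `y`, as an element of `L¹`. -/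
def mulConj (x y : L2) : L1 :=
  MemLp.toLp (fun t => x t * conj (y t)) (MemLp.mul (r := 1) (Lp.memLp y).star (Lp.memLp x))

/-- For a product `B` of `L²` functions with values in `L¹`: the sequences `x`, `y` in `K_θ`
represent `f` as `∑ B (x k) (y k)` with `∑ ‖x k‖ ‖y k‖ < ∞`
(such a series converges absolutely in `L¹`; finite sums are padded by zeros). -/
structure Represents (θ : ℂ → ℂ) (B : L2 → L2 → L1) (x y : ℕ → L2) (f : L1) : Prop where
  left_mem : ∀ k, x k ∈ K θ
  right_mem : ∀ k, y k ∈ K θ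
  summable : Summable fun k => ‖x k‖ * ‖y k‖
  hasSum : HasSum (fun k => B (x k) (y k)) f

/-- The elements of `L¹` that have a representation with respect to the product `B`. -/
def seriesSpace (θ : ℂ → ℂ) (B : L2 → L2 → L1) : Set L1 :=
  {f | ∃ x y, Represents θ B x y f}

/-- The infimum of `∑ ‖x k‖ ‖y k‖` over all representations of `f`. -/
def seriesNorm (θ : ℂ → ℂ) (B : L2 → L2 → L1) (f : L1) : ℝ :=
  sInf {s | ∃ x y, Represents θ B x y f ∧ s = ∑' k, ‖x k‖ * ‖y k‖}

/-- The space `X` of all `∑ x k * conj (y k)`. -/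
def X (θ : ℂ → ℂ) : Set L1 := seriesSpace θ mulConj

/-- The norm of the space `X`. -/
def normX (θ : ℂ → ℂ) (f : L1) : ℝ := seriesNorm θ mulConj f

/-- The analytic analog `X_a` of `X`: the space of all `∑ x k * y k`. -/
def Xa (θ : ℂ → ℂ) : Set L1 := seriesSpace θ mul

/-- The norm of the space `X_a`. -/
def normXa (θ : ℂ → ℂ) (f : L1) : ℝ := seriesNorm θ mul f

/-- Nonnegativity almost everywhere (in particular, real values) of a function on the circle. -/
def Nonneg (f : L1) : Prop := ∀ᵐ t ∂m, 0 ≤ f t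

end ModelSpace

end

/-!
On the circle an inner function enters only through the unimodular function `φ = θ z̄`: the space
`K θ` consists of the `f ∈ H²` with `φ f̄ ∈ H²`, and `y ↦ φ ȳ` is an isometric involution of `K θ`
(`unimodConj`). Hence for `f ∈ X` the function `φ f` is a series of products of two `H²` functions
and has no Fourier coefficients of negative index.

If moreover `f ≥ 0`, a factorization `f = |g|²` with `g ∈ K θ` is obtained by Szegő's extremal
argument in place of outer functions (`exists_spectral_factor`): for `w = √f`, let `v` be the
component of `w` orthogonal to the closed span of `zᵏ w`, `k ≥ 1`. All Fourier coefficients of `|v|²`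
of nonzero index vanish, so `|v|` is constant, and if `v ≠ 0` then `g = v̄ w / ‖v‖` has `|g|² = f`.
Orthogonality gives `g ∈ H²`, and `φ ḡ = φ w v / ‖v‖ ∈ H²` because `v` is a limit of combinations
of `zᵏ w`, `k ≥ 0`, while `φ w (zᵏ w) = zᵏ φ f` has no negative frequencies. If `v = 0`, the same
argument shows that all Fourier coefficients of `φ f` vanish, so `f = 0`.

For a representation `f = ∑ xⱼ ȳⱼ` with `‖xⱼ‖ = ‖yⱼ‖` and `S = ∑ ‖xⱼ‖ ‖yⱼ‖`, polarization writes `f`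
as `∑ₖ (iᵏ / 4) hₖ`, where `hₖ = ∑ⱼ |xⱼ + iᵏ yⱼ|² = |gₖ|²` and `‖gₖ‖² / 4 ≤ (S + |∫ f|) / 2`
(`exists_four_nonneg`). If `|∫ f| < ‖f‖_X`, this is at most `‖f‖_X` as soon as `S` is close enough to
the infimum. Otherwise `|∫ f| = ‖f‖₁`, so `f` is a constant multiple of a nonnegative function and a
single product represents it. Multiplication by `φ` is an isometry from `X` onto `X_a` that maps
`x ȳ` to `x (φ ȳ)`, which transfers the result to `X_a`.
-/

noncomputable section

namespace ModelSpace


/-! ### Uniqueness of Fourier coefficients in `L¹` -/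

/-- An integrable function on the circle all of whose Fourier coefficients vanish is zero: its
integrals against trigonometric polynomials, hence against continuous functions and indicators of
closed sets, vanish. -/
theorem ae_eq_zero_of_integral_fourier {f : UnitAddCircle → ℂ} (hf : Integrable f m)
    (h : ∀ n : ℤ, ∫ t, fourier n t * f t ∂m = 0) : f =ᵐ[m] 0 := by
  have hint (g : C(UnitAddCircle, ℂ)) : Integrable (fun t => g t * f t) m :=
    hf.bdd_mul (c := ‖g‖) g.continuous.aestronglyMeasurable
      (Eventually.of_forall fun t => g.norm_coe_le_norm t)
  let Φ : C(UnitAddCircle, ℂ) →L[ℂ] ℂ := LinearMap.mkContinuous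
    { toFun := fun g => ∫ t, g t * f t ∂m
      map_add' := fun g₁ g₂ => by
        rw [← integral_add (hint g₁) (hint g₂)]
        simp [add_mul]
      map_smul' := fun c g => by
        simp [mul_assoc, integral_const_mul] } (∫ t, ‖f t‖ ∂m) (fun g => by
      simp only [LinearMap.coe_mk, AddHom.coe_mk]
      refine (norm_integral_le_integral_norm _).trans ?_
      rw [mul_comm, ← integral_const_mul]
      refine integral_mono (hint g).norm (hf.norm.const_mul _) fun t => ?_
      simp only [norm_mul]
      gcongr
      exact g.norm_coe_le_norm t)
  have hΦ : Φ = 0 := ContinuousLinearMap.ext_on (s := Set.range (@fourier 1))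
    (by rw [← Submodule.dense_iff_topologicalClosure_eq_top.symm.eq]
        exact span_fourier_closure_eq_top)
    (by rintro _ ⟨n, rfl⟩; exact h n)
  have hcont (g : C(UnitAddCircle, ℂ)) : ∫ t, g t * f t ∂m = 0 :=
    congrArg (fun L : C(UnitAddCircle, ℂ) →L[ℂ] ℂ => L g) hΦ
  refine ae_eq_zero_of_forall_setIntegral_isClosed_eq_zero hf fun F hF => ?_
  have hlim : Tendsto (fun n => ∫ t, ((hF.apprSeq n t : ℝ) : ℂ) * f t ∂m) atTop
      (𝓝 (∫ t, F.indicator f t ∂m)) := by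
    refine tendsto_integral_of_dominated_convergence (fun t => ‖f t‖) (fun n => ?_) hf.norm
      (fun n => Eventually.of_forall fun t => ?_) (Eventually.of_forall fun t => ?_)
    · exact (hint ⟨fun t => ((hF.apprSeq n t : ℝ) : ℂ), by fun_prop⟩).1
    · have : (hF.apprSeq n t : ℝ) ≤ 1 := by
        exact_mod_cast HasOuterApproxClosed.apprSeq_apply_le_one hF n t
      simp only [norm_mul, Complex.norm_real, NNReal.norm_eq]
      exact mul_le_of_le_one_left (norm_nonneg _) this
    · have h1 := (tendsto_pi_nhds.1 (HasOuterApproxClosed.tendsto_apprSeq hF)) t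
      have h2 : Tendsto (fun n => ((hF.apprSeq n t : ℝ) : ℂ) * f t) atTop
          (𝓝 ((((F.indicator (fun _ => (1 : NNReal)) t : NNReal) : ℝ) : ℂ) * f t)) :=
        ((Complex.continuous_ofReal.comp NNReal.continuous_coe).continuousAt.tendsto.comp
          h1).mul_const _
      convert h2 using 2
      by_cases ht : t ∈ F <;> simp [ht]
  rw [← integral_indicator hF.measurableSet]
  refine tendsto_nhds_unique hlim ?_
  have hz : ∀ n, ∫ t, ((hF.apprSeq n t : ℝ) : ℂ) * f t ∂m = 0 := fun n =>
    hcont ⟨fun t => ((hF.apprSeq n t : ℝ) : ℂ), by fun_prop⟩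
  simp only [hz, tendsto_const_nhds]

/-! ### Multiplication by unimodular functions -/

/-- A measurable function on the circle of modulus one almost everywhere. -/
structure IsUnimodular (φ : UnitAddCircle → ℂ) : Prop where
  aestronglyMeasurable : AEStronglyMeasurable φ m
  norm_eq_one : ∀ᵐ t ∂m, ‖φ t‖ = 1

theorem IsUnimodular.mul {φ ψ : UnitAddCircle → ℂ} (hφ : IsUnimodular φ) (hψ : IsUnimodular ψ) :
    IsUnimodular fun t => φ t * ψ t where
  aestronglyMeasurable := hφ.1.mul hψ.1
  norm_eq_one := by
    filter_upwards [hφ.2, hψ.2] with t h₁ h₂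
    simp [h₁, h₂]

theorem IsUnimodular.conj {φ : UnitAddCircle → ℂ} (hφ : IsUnimodular φ) :
    IsUnimodular fun t => conj (φ t) where
  aestronglyMeasurable := Complex.continuous_conj.comp_aestronglyMeasurable hφ.1
  norm_eq_one := by
    filter_upwards [hφ.2] with t h
    simp [h]

theorem IsUnimodular.conj_mul_self {φ : UnitAddCircle → ℂ} (hφ : IsUnimodular φ) :
    ∀ᵐ t ∂m, conj (φ t) * φ t = 1 := by
  filter_upwards [hφ.2] with t h
  rw [Complex.conj_mul', h]
  simp

theorem isUnimodular_fourier (n : ℤ) : IsUnimodular (fun t => fourier n t) where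
  aestronglyMeasurable := (fourier n).continuous.aestronglyMeasurable
  norm_eq_one := Eventually.of_forall fun t => by
    rw [fourier_apply]
    exact Circle.norm_coe _

theorem IsUnimodular.memLp_mul {φ : UnitAddCircle → ℂ} (hφ : IsUnimodular φ) {p : ℝ≥0∞}
    (f : Lp ℂ p m) : MemLp (fun t => φ t * f t) p m := by
  refine (Lp.memLp f).of_le (hφ.1.mul (Lp.aestronglyMeasurable f)) ?_
  filter_upwards [hφ.2] with t h
  simp [h]

/-- Multiplication by a unimodular function, as a linear isometry of `Lᵖ`. -/
def unimodMul (p : ℝ≥0∞) [Fact (1 ≤ p)] {φ : UnitAddCircle → ℂ} (hφ : IsUnimodular φ) :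
    Lp ℂ p m →ₗᵢ[ℂ] Lp ℂ p m where
  toFun f := (hφ.memLp_mul f).toLp _
  map_add' f g := by
    apply Lp.ext
    filter_upwards [(hφ.memLp_mul (f + g)).coeFn_toLp, (hφ.memLp_mul f).coeFn_toLp,
      (hφ.memLp_mul g).coeFn_toLp, Lp.coeFn_add f g,
      Lp.coeFn_add ((hφ.memLp_mul f).toLp _) ((hφ.memLp_mul g).toLp _)] with t h₁ h₂ h₃ h₄ h₅
    rw [h₁, h₅, Pi.add_apply, h₂, h₃, h₄, Pi.add_apply, mul_add]
  map_smul' c f := by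
    apply Lp.ext
    filter_upwards [(hφ.memLp_mul (c • f)).coeFn_toLp, (hφ.memLp_mul f).coeFn_toLp,
      Lp.coeFn_smul c f, Lp.coeFn_smul c ((hφ.memLp_mul f).toLp _)] with t h₁ h₂ h₃ h₄
    rw [RingHom.id_apply, h₁, h₄, Pi.smul_apply, h₂, h₃, Pi.smul_apply, smul_eq_mul, smul_eq_mul]
    ring
  norm_map' f := by
    change ‖(hφ.memLp_mul f).toLp _‖ = ‖f‖
    rw [Lp.norm_toLp, Lp.norm_def]
    congr 1
    refine eLpNorm_congr_norm_ae ?_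
    filter_upwards [hφ.2] with t h
    simp [h]

theorem coeFn_unimodMul (p : ℝ≥0∞) [Fact (1 ≤ p)] {φ : UnitAddCircle → ℂ} (hφ : IsUnimodular φ)
    (f : Lp ℂ p m) : unimodMul p hφ f =ᵐ[m] fun t => φ t * f t :=
  (hφ.memLp_mul f).coeFn_toLp

/-! ### The boundary function of an inner function -/

/-- A nontangential limit is the value of the boundary function, and it is also the radial limit. -/
theorem boundary_eq_of_tendsto {θ : ℂ → ℂ} {t : UnitAddCircle} {b : ℂ}
    (h : Tendsto θ (nontangential (z t)) (𝓝 b)) :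
    boundary θ t = b ∧
      Tendsto (fun n : ℕ => θ (((1 - 1 / ((n : ℝ) + 2) : ℝ) : ℂ) * z t)) atTop (𝓝 b) := by
  have hz : ‖z t‖ = 1 := Circle.norm_coe _
  -- The radius ending at `z t` lies in the Stolz region of aperture `2`.
  have hr : Tendsto (fun n : ℕ => ((1 - 1 / ((n : ℝ) + 2) : ℝ) : ℂ) * z t) atTop
      (nontangential (z t)) := by
    refine Tendsto.mono_right ?_ (le_iSup (fun M : ℝ => 𝓝[stolz (z t) M] (z t)) 2)
    refine tendsto_nhdsWithin_iff.2 ⟨?_, Eventually.of_forall fun n => ?_⟩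
    · have h1 : Tendsto (fun n : ℕ => 1 - 1 / ((n : ℝ) + 2)) atTop (𝓝 (1 - 0)) := by
        refine tendsto_const_nhds.sub ?_
        exact tendsto_const_nhds.div_atTop
          (tendsto_atTop_add_const_right _ _ tendsto_natCast_atTop_atTop)
      have h2 := ((Complex.continuous_ofReal.tendsto _).comp h1).mul_const (z t)
      simpa using h2
    · have hn : (0 : ℝ) < 1 / ((n : ℝ) + 2) := by positivity
      have hn1 : 1 / ((n : ℝ) + 2) < 1 := by
        rw [div_lt_one (by positivity)]
        linarith [(Nat.cast_nonneg n : (0 : ℝ) ≤ n)]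
      set ε : ℝ := 1 / ((n : ℝ) + 2)
      have e1 : ‖((1 - ε : ℝ) : ℂ) * z t‖ = 1 - ε := by
        rw [norm_mul, hz, mul_one, Complex.norm_real, Real.norm_of_nonneg (by linarith)]
      have e2 : z t - ((1 - ε : ℝ) : ℂ) * z t = (ε : ℂ) * z t := by
        push_cast
        ring
      refine ⟨by rw [e1]; linarith, ?_⟩
      rw [e1, e2, norm_mul, hz, mul_one, Complex.norm_real, Real.norm_of_nonneg hn.le]
      linarith
  have : (nontangential (z t)).NeBot := hr.neBot
  exact ⟨h.limUnder_eq, h.comp hr⟩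

theorem continuous_z : Continuous z := by
  unfold z
  fun_prop

theorem isUnimodular_z : IsUnimodular z where
  aestronglyMeasurable := continuous_z.aestronglyMeasurable
  norm_eq_one := Eventually.of_forall fun _ => Circle.norm_coe _

theorem IsInner.isUnimodular_boundary {θ : ℂ → ℂ} (hθ : IsInner θ) :
    IsUnimodular (boundary θ) where
  aestronglyMeasurable := by
    refine aestronglyMeasurable_of_tendsto_ae atTop
      (f := fun (n : ℕ) t => θ (((1 - 1 / ((n : ℝ) + 2) : ℝ) : ℂ) * z t)) (fun n => ?_) ?_
    · refine Continuous.aestronglyMeasurable ?_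
      refine hθ.analytic.continuousOn.comp_continuous (by have := continuous_z; fun_prop) fun t => ?_
      have hn : (0 : ℝ) < 1 / ((n : ℝ) + 2) := by positivity
      have hn1 : 1 / ((n : ℝ) + 2) < 1 := by
        rw [div_lt_one (by positivity)]
        linarith [(Nat.cast_nonneg n : (0 : ℝ) ≤ n)]
      rw [mem_ball_zero_iff, norm_mul, Complex.norm_real, Real.norm_of_nonneg (by linarith)]
      simp only [z, Circle.norm_coe, mul_one]
      linarith
    · filter_upwards [hθ.unimodular] with t ⟨b, _, hb⟩
      obtain ⟨h1, h2⟩ := boundary_eq_of_tendsto hb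
      rwa [h1]
  norm_eq_one := by
    filter_upwards [hθ.unimodular] with t ⟨b, hb1, hb⟩
    rw [(boundary_eq_of_tendsto hb).1, hb1]

/-! ### Conjugations of `L²` -/

theorem norm_star_L2 (y : L2) : ‖star y‖ = ‖y‖ := by
  rw [Lp.norm_def, Lp.norm_def]
  congr 1
  refine eLpNorm_congr_norm_ae ?_
  filter_upwards [Lp.coeFn_star y] with t h
  rw [h, Pi.star_apply, norm_star]

/-- The conjugation `y ↦ φ ȳ` of `L²` attached to a unimodular function `φ`. For `φ = θ z̄` it is
the natural involution of the model space `K θ`. -/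
def unimodConj {φ : UnitAddCircle → ℂ} (hφ : IsUnimodular φ) (y : L2) : L2 :=
  unimodMul 2 hφ (star y)

theorem coeFn_unimodConj {φ : UnitAddCircle → ℂ} (hφ : IsUnimodular φ) (y : L2) :
    unimodConj hφ y =ᵐ[m] fun t => φ t * conj (y t) := by
  filter_upwards [coeFn_unimodMul 2 hφ (star y), Lp.coeFn_star y] with t h₁ h₂
  rw [unimodConj, h₁, h₂]
  rfl

theorem norm_unimodConj {φ : UnitAddCircle → ℂ} (hφ : IsUnimodular φ) (y : L2) :
    ‖unimodConj hφ y‖ = ‖y‖ := by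
  rw [unimodConj, LinearIsometry.norm_map, norm_star_L2]

theorem unimodConj_unimodConj {φ : UnitAddCircle → ℂ} (hφ : IsUnimodular φ) (y : L2) :
    unimodConj hφ (unimodConj hφ y) = y := by
  apply Lp.ext
  filter_upwards [coeFn_unimodConj hφ (unimodConj hφ y), coeFn_unimodConj hφ y,
    hφ.conj_mul_self] with t h₁ h₂ h₃
  rw [h₁, h₂, map_mul, Complex.conj_conj]
  linear_combination y t * h₃

/-! ### Hardy space products -/

theorem inner_eq_integral (x y : L2) : inner ℂ x y = ∫ t, y t * conj (x t) ∂m := rfl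

theorem inner_star_eq_integral (x y : L2) : inner ℂ (star x) y = ∫ t, x t * y t ∂m := by
  rw [inner_eq_integral]
  refine integral_congr_ae ?_
  filter_upwards [Lp.coeFn_star x] with t h
  rw [h, Pi.star_apply, ← starRingEnd_apply, Complex.conj_conj, mul_comm]

theorem mem_hardy2_iff {f : L2} :
    f ∈ hardy2 ↔ ∀ n : ℤ, 0 < n → ∫ t, fourier n t * f t ∂m = 0 := by
  constructor
  · intro h n hn
    simpa [fourierCoeff] using h (-n) (by omega)
  · intro h n hn
    simpa [fourierCoeff] using h (-n) (by omega)

/-- The product of two functions in `H²` has no Fourier coefficients of negative index: expand one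
factor in its Fourier series. -/
theorem integral_fourier_mul_mul_of_mem_hardy2 {x g : L2} (hx : x ∈ hardy2) (hg : g ∈ hardy2)
    {n : ℤ} (hn : 0 < n) : ∫ t, fourier n t * (x t * g t) ∂m = 0 := by
  set a : L2 := unimodMul 2 (isUnimodular_fourier n) x with ha
  have hat := coeFn_unimodMul 2 (isUnimodular_fourier n) x
  have key : ∀ b : L2, innerSL ℂ (star a) b = ∫ t, fourier n t * (x t * b t) ∂m := by
    intro b
    rw [innerSL_apply_apply, inner_star_eq_integral]
    refine integral_congr_ae ?_
    filter_upwards [hat] with t h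
    rw [ha, h, mul_assoc]
  have hs := (hasSum_fourier_series_L2 g).mapL (innerSL ℂ (star a))
  rw [← key g]
  refine hs.unique ?_
  convert! hasSum_zero using 1
  funext k
  rw [map_smul, key]
  rcases lt_or_ge k 0 with hk | hk
  · rw [hg k hk, zero_smul]
  · rw [smul_eq_zero]
    right
    rw [← mem_hardy2_iff.1 hx (n + k) (by omega)]
    refine integral_congr_ae ?_
    filter_upwards [coeFn_fourierLp (T := 1) 2 k] with t h
    rw [h, fourier_add]
    ring

/-! ### Spectral factorization -/

theorem integral_fourier_eq_zero {n : ℤ} (hn : n ≠ 0) :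
    ∫ t : UnitAddCircle, fourier n t ∂m = 0 := by
  have h := congrFun (fourierCoeff_fourier (T := 1) n) 0
  rw [Pi.single_eq_of_ne hn.symm] at h
  simpa [fourierCoeff] using h

/-- If `v` is orthogonal in `L²` to `zⁿ v` for all `n ≥ 1`, then `|v|` is constant. -/
theorem norm_ae_eq_of_inner_shift_eq_zero {v : L2}
    (h : ∀ n : ℤ, 0 < n → ∫ t, fourier n t * (v t * conj (v t)) ∂m = 0) :
    ∀ᵐ t ∂m, ‖v t‖ = ‖v‖ := by
  have hint : Integrable (fun t => v t * conj (v t)) m :=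
    L2.integrable_inner (𝕜 := ℂ) v v
  have h0 : ∫ t, v t * conj (v t) ∂m = (‖v‖ : ℂ) ^ 2 := by
    rw [← inner_eq_integral, inner_self_eq_norm_sq_to_K]
    rfl
  have hneg : ∀ n : ℤ, 0 < n → ∫ t, fourier (-n) t * (v t * conj (v t)) ∂m = 0 := by
    intro n hn
    rw [← map_zero (starRingEnd ℂ), ← h n hn, ← integral_conj]
    congr 1
    funext t
    rw [fourier_neg]
    simp only [map_mul, Complex.conj_conj]
    ring
  have hz : (fun t => v t * conj (v t) - (‖v‖ : ℂ) ^ 2) =ᵐ[m] 0 := by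
    refine ae_eq_zero_of_integral_fourier (hint.sub (integrable_const _)) fun n => ?_
    have hf : Integrable (fun t => fourier n t * (v t * conj (v t))) m := by
      refine hint.bdd_mul (c := 1) (isUnimodular_fourier n).1 ?_
      filter_upwards [(isUnimodular_fourier n).2] with t ht using ht.le
    have hg : Integrable (fun t : UnitAddCircle => fourier n t * (‖v‖ : ℂ) ^ 2) m := by
      refine (integrable_const _).bdd_mul (c := 1) (isUnimodular_fourier n).1 ?_
      filter_upwards [(isUnimodular_fourier n).2] with t ht using ht.le
    simp only [mul_sub]
    rw [integral_sub hf hg, integral_mul_const]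
    rcases lt_trichotomy n 0 with hn | rfl | hn
    · rw [integral_fourier_eq_zero hn.ne, ← neg_neg n, hneg (-n) (by omega)]
      simp
    · simp [h0]
    · rw [integral_fourier_eq_zero hn.ne', h n hn]
      simp
  filter_upwards [hz] with t ht
  simp only [Pi.zero_apply, Complex.mul_conj', sub_eq_zero] at ht
  exact (pow_left_inj₀ (norm_nonneg _) (norm_nonneg _) two_ne_zero).1 (by exact_mod_cast ht)

/-- A nonnegative `f ∈ L¹` such that `φ f` has no Fourier coefficients of negative index is `|g|²`
for some `g ∈ H²` with `φ ḡ ∈ H²`. With `w = √f` and `v` the component of `w` orthogonal to the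
closed span of `zᵏ w`, `k ≥ 1`, the modulus of `v` is constant, and `g = v̄ w / ‖v‖` works. If
`v = 0`, then the negative Fourier coefficients of `φ f` being zero forces all the others to be zero,
one after the other, so `f = 0`. -/
theorem exists_spectral_factor {φ : UnitAddCircle → ℂ} (hφ : IsUnimodular φ) {f : L1}
    (hf : Nonneg f) (h : ∀ n : ℤ, 0 < n → ∫ t, fourier n t * (φ t * f t) ∂m = 0) :
    ∃ g ∈ hardy2, unimodConj hφ g ∈ hardy2 ∧ ∀ᵐ t ∂m, f t = ((‖g t‖ ^ 2 : ℝ) : ℂ) := by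
  have hfint : Integrable f m := L1.integrable_coeFn f
  have hsqrt : MemLp (fun t => ((√(f t).re : ℝ) : ℂ)) 2 m := by
    have hm : AEStronglyMeasurable (fun t => ((√(f t).re : ℝ) : ℂ)) m :=
      (Complex.continuous_ofReal.comp (Real.continuous_sqrt.comp
        Complex.continuous_re)).comp_aestronglyMeasurable hfint.1
    rw [memLp_two_iff_integrable_sq_norm hm]
    refine hfint.re.congr ?_
    filter_upwards [hf] with t ht
    rw [Complex.norm_real, Real.norm_eq_abs, sq_abs, Real.sq_sqrt (Complex.nonneg_iff.1 ht).1]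
    rfl
  set w : L2 := hsqrt.toLp _
  have hw : ∀ᵐ t ∂m, w t * w t = f t ∧ conj (w t) = w t := by
    filter_upwards [hsqrt.coeFn_toLp, hf] with t h₁ h₂
    obtain ⟨h₃, h₄⟩ := Complex.nonneg_iff.1 h₂
    refine ⟨?_, by rw [h₁, Complex.conj_ofReal]⟩
    rw [h₁, ← Complex.ofReal_mul, Real.mul_self_sqrt h₃]
    exact Complex.ext rfl (by simpa using h₄)
  set e : ℤ → L2 := fun n => unimodMul 2 (isUnimodular_fourier n) w
  have he (n : ℤ) : ∀ᵐ t ∂m, e n t = fourier n t * w t :=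
    coeFn_unimodMul 2 (isUnimodular_fourier n) w
  have he0 : e 0 = w := by
    apply Lp.ext
    filter_upwards [he 0] with t ht
    simp [ht]
  let V : Submodule ℂ L2 :=
    (Submodule.span ℂ (Set.range fun k : ℕ => e (k + 1))).topologicalClosure
  have hVker (L : L2 →L[ℂ] ℂ) (hL : ∀ k : ℕ, L (e (k + 1)) = 0) : ∀ x ∈ V, L x = 0 := by
    have : V ≤ LinearMap.ker (L : L2 →ₗ[ℂ] ℂ) := by
      refine Submodule.topologicalClosure_minimal _ (Submodule.span_le.2 ?_) L.isClosed_ker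
      rintro _ ⟨k, rfl⟩
      exact hL k
    exact fun x hx => this hx
  have : CompleteSpace V :=
    (Submodule.isClosed_topologicalClosure _).completeSpace_coe
  set v : L2 := w - V.starProjection w with hv
  have hvker (L : L2 →L[ℂ] ℂ) (hL : ∀ k : ℕ, L (e k) = 0) : L v = 0 := by
    have h0 : L w = 0 := by
      rw [← he0]
      exact_mod_cast hL 0
    rw [hv, map_sub, h0,
      hVker L (fun k => by exact_mod_cast hL (k + 1)) _ (V.starProjection_apply_mem w), sub_zero]
  have hvorth (k : ℕ) : inner ℂ v (e (k + 1)) = 0 := by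
    have heV : e (k + 1) ∈ V :=
      Submodule.le_topologicalClosure _ (Submodule.subset_span ⟨k, rfl⟩)
    exact Submodule.inner_left_of_mem_orthogonal heV (V.sub_starProjection_mem_orthogonal w)
  have hvorth' {n : ℤ} (hn : 0 < n) : inner ℂ v (e n) = 0 := by
    obtain ⟨k, rfl⟩ : ∃ k : ℕ, n = k + 1 := ⟨(n - 1).toNat, by omega⟩
    exact hvorth k
  -- The functional `x ↦ ∫ zⁿ φ w x`, which maps `zᵏ w` to a Fourier coefficient of `φ f`.
  let L (n : ℤ) : L2 →L[ℂ] ℂ :=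
    innerSL ℂ (star (unimodMul 2 (hφ.mul (isUnimodular_fourier n)) w))
  have hL (n : ℤ) (x : L2) : L n x = ∫ t, fourier n t * (φ t * (w t * x t)) ∂m := by
    simp only [L]
    rw [innerSL_apply_apply, inner_star_eq_integral]
    refine integral_congr_ae ?_
    filter_upwards [coeFn_unimodMul 2 (hφ.mul (isUnimodular_fourier n)) w] with t ht
    rw [ht]
    ring
  have hLe (n k : ℤ) : L n (e k) = ∫ t, fourier (n + k) t * (φ t * f t) ∂m := by
    rw [hL]
    refine integral_congr_ae ?_
    filter_upwards [hw, he k] with t h₁ h₂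
    rw [h₂, ← h₁.1, fourier_add]
    ring
  by_cases hv0 : v = 0
  · have hwV : w ∈ V := by
      rw [hv, sub_eq_zero] at hv0
      rw [hv0]
      exact V.starProjection_apply_mem w
    -- If `∫ zⁿ φ f = 0` for all `n > -N`, the functional `L (-N)` kills `zᵏ w` for `k ≥ 1`,
    -- hence also `w ∈ V`, so `∫ zⁿ φ f = 0` for `n = -N` as well.
    have hall : ∀ N : ℕ, ∀ n : ℤ, -(N : ℤ) < n → ∫ t, fourier n t * (φ t * f t) ∂m = 0 := by
      intro N
      induction N with
      | zero => exact fun n hn => h n (by simpa using hn)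
      | succ N ih =>
        intro n hn
        have := hVker (L n) (fun k => by rw [hLe]; exact ih _ (by push_cast at hn; omega)) w hwV
        rw [← he0, hLe, add_zero] at this
        exact this
    have hφf : Integrable (fun t => φ t * f t) m := by
      refine hfint.bdd_mul (c := 1) hφ.1 ?_
      filter_upwards [hφ.2] with t ht using ht.le
    have hz := ae_eq_zero_of_integral_fourier hφf fun n => hall (n.natAbs + 1) n (by omega)
    refine ⟨0, hardy2.zero_mem, ?_, ?_⟩
    · have : unimodConj hφ 0 = 0 := by rw [← norm_eq_zero, norm_unimodConj, norm_zero]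
      rw [this]
      exact hardy2.zero_mem
    · filter_upwards [hz, hφ.2] with t h₁ h₂
      have : φ t ≠ 0 := by
        rw [← norm_ne_zero_iff, h₂]
        exact one_ne_zero
      have h₄ : f t = 0 := by simpa [this] using h₁
      simp [h₄]
  have hvnorm : ∀ᵐ t ∂m, ‖v t‖ = ‖v‖ := by
    refine norm_ae_eq_of_inner_shift_eq_zero fun n hn => ?_
    let M : L2 →L[ℂ] ℂ :=
      (innerSL ℂ v).comp (unimodMul 2 (isUnimodular_fourier n)).toContinuousLinearMap
    have hM : M v = 0 := by
      refine hvker M fun k => ?_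
      have : unimodMul 2 (isUnimodular_fourier n) (e k) = e (n + k) := by
        apply Lp.ext
        filter_upwards [coeFn_unimodMul 2 (isUnimodular_fourier n) (e k), he k,
          he (n + k)] with t h₁ h₂ h₃
        rw [h₁, h₂, h₃, fourier_add, mul_assoc]
      change inner ℂ v (unimodMul 2 (isUnimodular_fourier n) (e k)) = 0
      rw [this]
      exact hvorth' (by omega)
    rw [← hM]
    change _ = inner ℂ v (unimodMul 2 (isUnimodular_fourier n) v)
    rw [inner_eq_integral]
    refine integral_congr_ae ?_
    filter_upwards [coeFn_unimodMul 2 (isUnimodular_fourier n) v] with t ht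
    rw [ht, mul_assoc]
  have hvpos : (‖v‖ : ℂ) ≠ 0 := by simpa using hv0
  have hu : IsUnimodular fun t => conj (v t) * (‖v‖ : ℂ)⁻¹ := by
    refine ⟨(Complex.continuous_conj.comp_aestronglyMeasurable
      (Lp.aestronglyMeasurable v)).mul_const _, ?_⟩
    filter_upwards [hvnorm] with t ht
    rw [norm_mul, RCLike.norm_conj, ht, norm_inv, Complex.norm_real, norm_norm]
    exact mul_inv_cancel₀ (by simpa using hv0)
  have hg := coeFn_unimodMul 2 hu w
  refine ⟨unimodMul 2 hu w, ?_, ?_, ?_⟩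
  · rw [mem_hardy2_iff]
    intro n hn
    have h1 : ∫ t, e n t * conj (v t) ∂m = 0 := hvorth' hn
    rw [← zero_mul ((‖v‖ : ℂ)⁻¹), ← h1, ← integral_mul_const]
    refine integral_congr_ae ?_
    filter_upwards [hg, he n] with t h₁ h₂
    rw [h₁, h₂]
    ring
  · rw [mem_hardy2_iff]
    intro n hn
    have h1 := hvker (L n) (fun k => by rw [hLe]; exact h _ (by omega))
    rw [hL] at h1
    rw [← zero_mul ((‖v‖ : ℂ)⁻¹), ← h1, ← integral_mul_const]
    refine integral_congr_ae ?_
    filter_upwards [hg, hw, coeFn_unimodConj hφ (unimodMul 2 hu w)] with t h₁ h₂ h₃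
    rw [h₃, h₁]
    simp only [map_mul, map_inv₀, Complex.conj_ofReal, Complex.conj_conj, h₂.2]
    ring
  · filter_upwards [hg, hw, hu.2] with t h₁ h₂ h₃
    rw [h₁, norm_mul, h₃, one_mul, ← h₂.1]
    push_cast
    rw [← Complex.mul_conj', h₂.2]

/-! ### The involution of the model space -/

/-- The unimodular function `θ z̄` on the circle: `K θ` consists of the `f ∈ H²` such that
`θ z̄ f̄ ∈ H²`. -/
def phase (θ : ℂ → ℂ) (t : UnitAddCircle) : ℂ := boundary θ t * conj (z t)

theorem IsInner.isUnimodular_phase {θ : ℂ → ℂ} (hθ : IsInner θ) : IsUnimodular (phase θ) :=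
  hθ.isUnimodular_boundary.mul isUnimodular_z.conj

theorem mem_K_iff {θ : ℂ → ℂ} (hφ : IsUnimodular (phase θ)) {f : L2} :
    f ∈ K θ ↔ f ∈ hardy2 ∧ unimodConj hφ f ∈ hardy2 := by
  constructor
  · rintro ⟨hf, g, hg, h⟩
    refine ⟨hf, ?_⟩
    have : f = unimodConj hφ g := by
      apply Lp.ext
      filter_upwards [h, coeFn_unimodConj hφ g] with t h₁ h₂
      rw [h₁, h₂, phase, map_mul, mul_assoc]
    rwa [this, unimodConj_unimodConj]
  · rintro ⟨hf, hg⟩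
    refine ⟨hf, _, hg, ?_⟩
    filter_upwards [coeFn_unimodConj hφ (unimodConj hφ f)] with t h
    rw [unimodConj_unimodConj] at h
    rw [h, phase, map_mul, mul_assoc]

theorem unimodConj_mem_K {θ : ℂ → ℂ} (hφ : IsUnimodular (phase θ)) {f : L2} (hf : f ∈ K θ) :
    unimodConj hφ f ∈ K θ := by
  rw [mem_K_iff hφ] at hf ⊢
  rw [unimodConj_unimodConj]
  exact hf.symm

/-! ### Products of `L²` functions -/

theorem coeFn_mul (x y : L2) : mul x y =ᵐ[m] fun t => x t * y t := MemLp.coeFn_toLp _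

theorem coeFn_mulConj (x y : L2) : mulConj x y =ᵐ[m] fun t => x t * conj (y t) :=
  MemLp.coeFn_toLp _

theorem mulConj_smul_left (c : ℂ) (x y : L2) : mulConj (c • x) y = c • mulConj x y := by
  apply Lp.ext
  filter_upwards [coeFn_mulConj (c • x) y, coeFn_mulConj x y, Lp.coeFn_smul c x,
    Lp.coeFn_smul c (mulConj x y)] with t h₁ h₂ h₃ h₄
  rw [h₁, h₄, Pi.smul_apply, h₂, h₃, Pi.smul_apply, smul_eq_mul, smul_eq_mul, mul_assoc]

theorem mulConj_smul_right (c : ℂ) (x y : L2) : mulConj x (c • y) = conj c • mulConj x y := by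
  apply Lp.ext
  filter_upwards [coeFn_mulConj x (c • y), coeFn_mulConj x y, Lp.coeFn_smul c y,
    Lp.coeFn_smul (conj c) (mulConj x y)] with t h₁ h₂ h₃ h₄
  rw [h₁, h₄, Pi.smul_apply, h₂, h₃, Pi.smul_apply, smul_eq_mul, smul_eq_mul, map_mul]
  ring

theorem mulConj_add_left (x x' y : L2) : mulConj (x + x') y = mulConj x y + mulConj x' y := by
  apply Lp.ext
  filter_upwards [coeFn_mulConj (x + x') y, coeFn_mulConj x y, coeFn_mulConj x' y,
    Lp.coeFn_add x x', Lp.coeFn_add (mulConj x y) (mulConj x' y)] with t h₁ h₂ h₃ h₄ h₅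
  rw [h₁, h₅, Pi.add_apply, h₂, h₃, h₄, Pi.add_apply, add_mul]

theorem mulConj_add_right (x y y' : L2) : mulConj x (y + y') = mulConj x y + mulConj x y' := by
  apply Lp.ext
  filter_upwards [coeFn_mulConj x (y + y'), coeFn_mulConj x y, coeFn_mulConj x y',
    Lp.coeFn_add y y', Lp.coeFn_add (mulConj x y) (mulConj x y')] with t h₁ h₂ h₃ h₄ h₅
  rw [h₁, h₅, Pi.add_apply, h₂, h₃, h₄, Pi.add_apply, map_add, mul_add]

theorem mulConj_zero_left (y : L2) : mulConj 0 y = 0 := by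
  simpa using mulConj_smul_left 0 0 y

/-- Polarization identity for `x ȳ`. -/
theorem mulConj_eq_sum (x y : L2) :
    mulConj x y = ∑ k : Fin 4, (Complex.I ^ (k : ℕ) / 4) •
      mulConj (x + Complex.I ^ (k : ℕ) • y) (x + Complex.I ^ (k : ℕ) • y) := by
  simp only [mulConj_add_left, mulConj_add_right, mulConj_smul_left, mulConj_smul_right,
    Fin.sum_univ_four]
  simp only [Fin.val_zero, Fin.val_one, Fin.val_two, show ((3 : Fin 4) : ℕ) = 3 from rfl, pow_zero,
    pow_one, Complex.I_sq, Complex.I_pow_three, map_one, map_neg, Complex.conj_I, smul_add,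
    smul_smul]
  match_scalars
  · linear_combination (1 / 2 : ℂ) * Complex.I_sq
  · ring
  · linear_combination (-1 / 2 : ℂ) * Complex.I_sq
  · ring

theorem norm_mulConj_le (x y : L2) : ‖mulConj x y‖ ≤ ‖x‖ * ‖y‖ := by
  rw [← norm_star_L2 y, Lp.norm_def, Lp.norm_def, Lp.norm_def, ← ENNReal.toReal_mul]
  refine ENNReal.toReal_mono
    (ENNReal.mul_ne_top (Lp.eLpNorm_ne_top x) (Lp.eLpNorm_ne_top (star y))) ?_
  refine le_of_eq_of_le (eLpNorm_congr_ae ?_)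
    (eLpNorm_smul_le_mul_eLpNorm (Lp.aestronglyMeasurable (star y)) (Lp.aestronglyMeasurable x))
  filter_upwards [coeFn_mulConj x y, Lp.coeFn_star y] with t h₁ h₂
  rw [h₁, Pi.smul_apply', h₂]
  rfl

/-- The integral over the circle, as a functional on `L¹`. -/
def integralL1 : L1 →L[ℂ] ℂ := LinearMap.mkContinuous
  { toFun := fun f => ∫ t, f t ∂m
    map_add' := fun f g => by
      rw [integral_congr_ae (Lp.coeFn_add f g)]
      exact integral_add (L1.integrable_coeFn f) (L1.integrable_coeFn g)
    map_smul' := fun c f => by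
      rw [integral_congr_ae (Lp.coeFn_smul c f)]
      exact integral_smul c _ } 1 fun f => by
    rw [one_mul, L1.norm_eq_integral_norm]
    exact norm_integral_le_integral_norm _

theorem integralL1_apply (f : L1) : integralL1 f = ∫ t, f t ∂m := rfl

theorem integralL1_mulConj (x y : L2) : integralL1 (mulConj x y) = inner ℂ y x := by
  rw [integralL1_apply, inner_eq_integral]
  exact integral_congr_ae (coeFn_mulConj x y)

theorem nonneg_of_hasSum {a : ℕ → L1} {f : L1} (ha : ∀ k, Nonneg (a k)) (h : HasSum a f) :
    Nonneg f := by
  have hs (n : ℕ) : Nonneg (∑ k ∈ Finset.range n, a k) := by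
    induction n with
    | zero =>
      filter_upwards [Lp.coeFn_zero ℂ 1 m] with t ht
      rw [Finset.sum_range_zero, ht]
      rfl
    | succ n ih =>
      rw [Finset.sum_range_succ]
      filter_upwards [ih, ha n, Lp.coeFn_add (∑ k ∈ Finset.range n, a k) (a n)] with t h₁ h₂ h₃
      rw [h₃]
      exact add_nonneg h₁ h₂
  obtain ⟨ns, -, hns⟩ := (tendstoInMeasure_of_tendsto_Lp h.tendsto_sum_nat).exists_seq_tendsto_ae
  filter_upwards [hns, ae_all_iff.2 hs] with t h₁ h₂
  exact ge_of_tendsto' h₁ fun i => h₂ (ns i)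

/-! ### Nonnegative elements of `X` -/

theorem integral_fourier_mul_eq_zero_of_mem_X {θ : ℂ → ℂ} (hφ : IsUnimodular (phase θ)) {f : L1}
    (hf : f ∈ X θ) {n : ℤ} (hn : 0 < n) : ∫ t, fourier n t * (phase θ t * f t) ∂m = 0 := by
  obtain ⟨x, y, hr⟩ := hf
  let Λ : L1 →L[ℂ] ℂ :=
    integralL1.comp (unimodMul 1 ((isUnimodular_fourier n).mul hφ)).toContinuousLinearMap
  have hΛ (g : L1) : Λ g = ∫ t, fourier n t * (phase θ t * g t) ∂m := by
    change integralL1 (unimodMul 1 ((isUnimodular_fourier n).mul hφ) g) = _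
    rw [integralL1_apply]
    refine integral_congr_ae ?_
    filter_upwards [coeFn_unimodMul 1 ((isUnimodular_fourier n).mul hφ) g] with t ht
    rw [ht, mul_assoc]
  rw [← hΛ]
  refine (hr.hasSum.mapL Λ).unique ?_
  convert! hasSum_zero using 1
  funext k
  rw [hΛ, ← integral_fourier_mul_mul_of_mem_hardy2 ((mem_K_iff hφ).1 (hr.left_mem k)).1
    ((mem_K_iff hφ).1 (hr.right_mem k)).2 hn]
  refine integral_congr_ae ?_
  filter_upwards [coeFn_mulConj (x k) (y k), coeFn_unimodConj hφ (y k)] with t h₁ h₂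
  rw [h₁, h₂]
  ring

theorem exists_eq_norm_sq_of_mem_X {θ : ℂ → ℂ} (hφ : IsUnimodular (phase θ)) {f : L1}
    (hf : f ∈ X θ) (hf0 : Nonneg f) :
    ∃ g ∈ K θ, ∀ᵐ t ∂m, f t = ((‖g t‖ ^ 2 : ℝ) : ℂ) := by
  obtain ⟨g, hg, hg', h⟩ := exists_spectral_factor hφ hf0
    fun n hn => integral_fourier_mul_eq_zero_of_mem_X hφ hf hn
  exact ⟨g, (mem_K_iff hφ).2 ⟨hg, hg'⟩, h⟩

theorem exists_eq_mulConj_self_of_mem_X {θ : ℂ → ℂ} (hφ : IsUnimodular (phase θ)) {f : L1}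
    (hf : f ∈ X θ) (hf0 : Nonneg f) : ∃ g ∈ K θ, f = mulConj g g := by
  obtain ⟨g, hg, h⟩ := exists_eq_norm_sq_of_mem_X hφ hf hf0
  refine ⟨g, hg, Lp.ext ?_⟩
  filter_upwards [h, coeFn_mulConj g g] with t h₁ h₂
  rw [h₁, h₂, Complex.mul_conj']
  push_cast
  rfl

/-! ### Representing series and their norms -/

theorem seriesNorm_le {θ : ℂ → ℂ} {B : L2 → L2 → L1} {x y : ℕ → L2} {f : L1}
    (h : Represents θ B x y f) : seriesNorm θ B f ≤ ∑' k, ‖x k‖ * ‖y k‖ := by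
  refine csInf_le ⟨0, ?_⟩ ⟨x, y, h, rfl⟩
  rintro _ ⟨x, y, -, rfl⟩
  exact tsum_nonneg fun k => by positivity

theorem norm_le_normX {θ : ℂ → ℂ} {f : L1} (hf : f ∈ X θ) : ‖f‖ ≤ normX θ f := by
  obtain ⟨x, y, h⟩ := hf
  refine le_csInf ⟨_, x, y, h, rfl⟩ ?_
  rintro _ ⟨x, y, h, rfl⟩
  have hs : Summable fun k => ‖mulConj (x k) (y k)‖ :=
    h.summable.of_nonneg_of_le (fun _ => norm_nonneg _) fun _ => norm_mulConj_le _ _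
  rw [← h.hasSum.tsum_eq]
  exact (norm_tsum_le_tsum_norm hs).trans
    (hs.tsum_le_tsum (fun _ => norm_mulConj_le _ _) h.summable)

theorem represents_single {θ : ℂ → ℂ} {x y : L2} (hx : x ∈ K θ) (hy : y ∈ K θ) :
    Represents θ mulConj (Pi.single 0 x) (Pi.single 0 y) (mulConj x y) where
  left_mem k := by
    rcases k with _ | k
    · simpa using hx
    · simp
  right_mem k := by
    rcases k with _ | k
    · simpa using hy
    · simp
  summable := summable_of_ne_finset_zero (s := {0}) fun k hk => by
    rw [Pi.single_eq_of_ne (by simpa using hk), norm_zero, zero_mul]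
  hasSum := by
    refine hasSum_single (f := fun k => mulConj (Pi.single (M := fun _ => L2) 0 x k)
      (Pi.single (M := fun _ => L2) 0 y k)) 0 fun k hk => ?_
    rw [Pi.single_eq_of_ne hk, mulConj_zero_left]

theorem normX_mulConj_le {θ : ℂ → ℂ} {x y : L2} (hx : x ∈ K θ) (hy : y ∈ K θ) :
    normX θ (mulConj x y) ≤ ‖x‖ * ‖y‖ := by
  refine (seriesNorm_le (represents_single hx hy)).trans_eq ?_
  rw [tsum_eq_single 0 fun k hk => by rw [Pi.single_eq_of_ne hk, norm_zero, zero_mul]]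
  simp

theorem normX_nonneg (θ : ℂ → ℂ) (f : L1) : 0 ≤ normX θ f := by
  refine Real.sInf_nonneg ?_
  rintro _ ⟨x, y, -, rfl⟩
  exact tsum_nonneg fun k => by positivity

theorem smul_mem_X {θ : ℂ → ℂ} (c : ℂ) {f : L1} (hf : f ∈ X θ) : c • f ∈ X θ := by
  obtain ⟨x, y, h⟩ := hf
  refine ⟨fun k => c • x k, y, fun k => (K θ).smul_mem c (h.left_mem k), h.right_mem, ?_, ?_⟩
  · simpa only [norm_smul, mul_assoc] using h.summable.mul_left ‖c‖
  · simpa only [mulConj_smul_left] using h.hasSum.const_smul c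

/-- A product `x ȳ` can be rescaled so that its factors have equal norms. -/
theorem exists_balanced {θ : ℂ → ℂ} {x y : L2} (hx : x ∈ K θ) (hy : y ∈ K θ) :
    ∃ x' ∈ K θ, ∃ y' ∈ K θ, mulConj x' y' = mulConj x y ∧
      ‖x'‖ ^ 2 = ‖x‖ * ‖y‖ ∧ ‖y'‖ ^ 2 = ‖x‖ * ‖y‖ := by
  rcases eq_or_ne x 0 with rfl | hx0
  · exact ⟨0, zero_mem _, 0, zero_mem _, by simp [mulConj_zero_left], by simp, by simp⟩
  rcases eq_or_ne y 0 with rfl | hy0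
  · refine ⟨0, zero_mem _, 0, zero_mem _, ?_, by simp, by simp⟩
    rw [mulConj_zero_left]
    simpa using (mulConj_smul_right 0 x 0).symm
  have hx1 : 0 < ‖x‖ := norm_pos_iff.2 hx0
  have hy1 : 0 < ‖y‖ := norm_pos_iff.2 hy0
  have hr : 0 < ‖y‖ / ‖x‖ := by positivity
  set r : ℝ := √(‖y‖ / ‖x‖) with hrdef
  have hr0 : 0 < r := Real.sqrt_pos.2 hr
  have hr2 : r ^ 2 = ‖y‖ / ‖x‖ := Real.sq_sqrt hr.le
  refine ⟨(r : ℂ) • x, (K θ).smul_mem _ hx, ((r⁻¹ : ℝ) : ℂ) • y, (K θ).smul_mem _ hy, ?_, ?_, ?_⟩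
  · rw [mulConj_smul_left, mulConj_smul_right, Complex.conj_ofReal, smul_smul,
      ← Complex.ofReal_mul, mul_inv_cancel₀ hr0.ne', Complex.ofReal_one, one_smul]
  · rw [norm_smul, Complex.norm_real, mul_pow, Real.norm_eq_abs, sq_abs, hr2]
    field_simp
  · rw [norm_smul, Complex.norm_real, mul_pow, Real.norm_eq_abs, sq_abs, inv_pow, hr2]
    field_simp

/-! ### Decomposition into four terms -/

theorem norm_sq_add_smul (x y : L2) {c : ℂ} (hc : ‖c‖ = 1) :
    ‖x + c • y‖ ^ 2 = ‖x‖ ^ 2 + ‖y‖ ^ 2 + 2 * (conj c * inner ℂ y x).re := by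
  rw [@norm_add_sq ℂ, norm_smul, hc, one_mul, inner_smul_right, ← inner_conj_symm x y,
    ← Complex.conj_re (conj c * _), RingHom.map_mul, Complex.conj_conj, RCLike.re_eq_complex_re]
  ring

/-- The four nonnegative parts of `f = ∑ xⱼ ȳⱼ` are `∑ⱼ |xⱼ + iᵏ yⱼ|²` for balanced `xⱼ`, `yⱼ`. -/
theorem exists_four_nonneg {θ : ℂ → ℂ} {f : L1} {x y : ℕ → L2} (hr : Represents θ mulConj x y f) :
    ∃ h : Fin 4 → L1, (∀ k, h k ∈ X θ ∧ Nonneg (h k)) ∧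
      f = ∑ k : Fin 4, (Complex.I ^ (k : ℕ) / 4) • h k ∧
      ∀ k : Fin 4, (integralL1 (h k)).re ≤ 2 * ∑' j, ‖x j‖ * ‖y j‖ + 2 * ‖integralL1 f‖ := by
  choose x' hx' y' hy' hxy hnx hny using
    fun j => exists_balanced (hr.left_mem j) (hr.right_mem j)
  have hsum : HasSum (fun j => mulConj (x' j) (y' j)) f := by
    simpa only [hxy] using hr.hasSum
  let u (k : Fin 4) (j : ℕ) : L2 := x' j + Complex.I ^ (k : ℕ) • y' j
  have hI (k : Fin 4) : ‖Complex.I ^ (k : ℕ)‖ = 1 := by simp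
  have hu (k : Fin 4) (j : ℕ) : u k j ∈ K θ := add_mem (hx' j) ((K θ).smul_mem _ (hy' j))
  have hnorm (k : Fin 4) (j : ℕ) : ‖u k j‖ * ‖u k j‖ = 2 * (‖x j‖ * ‖y j‖) +
      2 * (conj (Complex.I ^ (k : ℕ)) * integralL1 (mulConj (x' j) (y' j))).re := by
    rw [← sq, norm_sq_add_smul _ _ (hI k), hnx, hny, integralL1_mulConj]
    ring
  have hsnorm (k : Fin 4) : HasSum (fun j => ‖u k j‖ * ‖u k j‖) (2 * ∑' j, ‖x j‖ * ‖y j‖ +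
      2 * (conj (Complex.I ^ (k : ℕ)) * integralL1 f).re) := by
    simp only [hnorm]
    exact (hr.summable.hasSum.mul_left 2).add
      ((Complex.hasSum_re ((hsum.mapL integralL1).mul_left _)).mul_left 2)
  have hs (k : Fin 4) : Summable fun j => mulConj (u k j) (u k j) :=
    .of_norm_bounded (hsnorm k).summable fun j => norm_mulConj_le _ _
  refine ⟨fun k => ∑' j, mulConj (u k j) (u k j), fun k => ⟨⟨u k, u k, hu k, hu k,
    (hsnorm k).summable, (hs k).hasSum⟩, nonneg_of_hasSum (fun j => ?_) (hs k).hasSum⟩, ?_,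
    fun k => ?_⟩
  · filter_upwards [coeFn_mulConj (u k j) (u k j)] with t ht
    rw [ht, Complex.mul_conj', ← Complex.ofReal_pow]
    exact Complex.zero_le_real.2 (sq_nonneg _)
  · refine hsum.unique ?_
    simp only [mulConj_eq_sum (x' _) (y' _)]
    exact hasSum_sum fun k _ => (hs k).hasSum.const_smul _
  · have h1 := Complex.hasSum_re ((hs k).hasSum.mapL integralL1)
    have h2 (j : ℕ) : (integralL1 (mulConj (u k j) (u k j))).re = ‖u k j‖ * ‖u k j‖ := by
      rw [integralL1_mulConj, ← sq]
      exact inner_self_eq_norm_sq (𝕜 := ℂ) (u k j)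
    simp only [h2] at h1
    rw [h1.unique (hsnorm k)]
    have h3 : (conj (Complex.I ^ (k : ℕ)) * integralL1 f).re ≤ ‖integralL1 f‖ := by
      refine (Complex.re_le_norm _).trans_eq ?_
      rw [norm_mul, RCLike.norm_conj, hI, one_mul]
    linarith

/-- If `|∫ f| = ‖f‖₁`, then `f` is a constant multiple of a nonnegative function. -/
theorem exists_smul_nonneg {f : L1} (h : ‖f‖ ≤ ‖integralL1 f‖) :
    ∃ c : ℂ, ‖c‖ = 1 ∧ Nonneg (c • f) := by
  obtain ⟨c, hc, hcf⟩ := Complex.exists_norm_eq_mul_self (integralL1 f)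
  refine ⟨c, hc, ?_⟩
  set F : L1 := c • f with hF
  have hFint : Integrable F m := L1.integrable_coeFn F
  have hre : ∫ t, (F t).re ∂m = ‖integralL1 f‖ := by
    have : integralL1 F = ‖integralL1 f‖ := by rw [hF, map_smul, smul_eq_mul, ← hcf]
    rw [← Complex.ofReal_re ‖integralL1 f‖, ← this, integralL1_apply]
    exact integral_re hFint
  have hn : ∫ t, ‖F t‖ ∂m = ‖f‖ := by
    rw [← L1.norm_eq_integral_norm, hF, norm_smul, hc, one_mul]
  have hpos : 0 ≤ fun t => ‖F t‖ - (F t).re := fun t => sub_nonneg.2 (Complex.re_le_norm _)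
  have hz : ∫ t, (‖F t‖ - (F t).re) ∂m = 0 := by
    refine le_antisymm ?_ (integral_nonneg hpos)
    have := integral_sub hFint.norm hFint.re
    simp only [RCLike.re_eq_complex_re] at this
    rw [this, hn, hre]
    linarith
  rw [integral_eq_zero_iff_of_nonneg hpos (hFint.norm.sub hFint.re)] at hz
  filter_upwards [hz] with t ht
  have h1 : (F t).re = ‖F t‖ := by
    simp only [Pi.zero_apply] at ht
    linarith
  exact Complex.re_eq_norm.1 h1

theorem exists_four_mulConj {θ : ℂ → ℂ} (hφ : IsUnimodular (phase θ)) {f : L1} (hf : f ∈ X θ) :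
    ∃ x y : Fin 4 → L2, (∀ j, x j ∈ K θ ∧ y j ∈ K θ) ∧ f = ∑ j, mulConj (x j) (y j) ∧
      ∀ j, normX θ (mulConj (x j) (y j)) ≤ normX θ f := by
  rcases lt_or_ge ‖integralL1 f‖ (normX θ f) with hlt | hge
  · -- A representation that is close enough to optimal makes all four terms small enough.
    obtain ⟨s, ⟨x, y, hr, rfl⟩, hs⟩ : ∃ s ∈ {s | ∃ x y, Represents θ mulConj x y f ∧
        s = ∑' k, ‖x k‖ * ‖y k‖}, s < 2 * normX θ f - ‖integralL1 f‖ := by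
      obtain ⟨x, y, h⟩ := hf
      refine exists_lt_of_csInf_lt ⟨_, x, y, h, rfl⟩ ?_
      change normX θ f < _
      linarith
    obtain ⟨h, hh, hfh, hint⟩ := exists_four_nonneg hr
    choose g hg hgh using fun k => exists_eq_mulConj_self_of_mem_X hφ (hh k).1 (hh k).2
    have hmem (k : Fin 4) : (Complex.I ^ (k : ℕ) / 4) • g k ∈ K θ := (K θ).smul_mem _ (hg k)
    refine ⟨fun k => (Complex.I ^ (k : ℕ) / 4) • g k, g, fun k => ⟨hmem k, hg k⟩, ?_, fun k => ?_⟩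
    · simp only [mulConj_smul_left, ← hgh]
      exact hfh
    · refine (normX_mulConj_le (hmem k) (hg k)).trans ?_
      have h1 : (integralL1 (h k)).re = ‖g k‖ ^ 2 := by
        rw [hgh k, integralL1_mulConj]
        exact inner_self_eq_norm_sq (𝕜 := ℂ) (g k)
      have h2 : ‖(Complex.I ^ (k : ℕ) / 4 : ℂ)‖ = 1 / 4 := by simp
      have h3 := hint k
      rw [norm_smul, h2]
      nlinarith
  · obtain ⟨c, hc, hcf⟩ := exists_smul_nonneg ((norm_le_normX hf).trans hge)
    obtain ⟨g, hg, hgf⟩ := exists_eq_mulConj_self_of_mem_X hφ (smul_mem_X c hf) hcf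
    have hfg : f = mulConj (conj c • g) g := by
      rw [mulConj_smul_left, ← hgf, smul_smul, Complex.conj_mul', hc]
      simp
    have hmem : conj c • g ∈ K θ := (K θ).smul_mem _ hg
    refine ⟨Pi.single 0 (conj c • g), Pi.single 0 g, fun j => ?_, ?_, fun j => ?_⟩
    · rcases eq_or_ne j 0 with rfl | hj
      · simpa using ⟨hmem, hg⟩
      · simp [hj]
    · rw [Finset.sum_eq_single 0 (fun j _ hj => by simp [hj, mulConj_zero_left]) (by simp)]
      simpa using hfg
    · rcases eq_or_ne j 0 with rfl | hj
      · simp [← hfg]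
      · refine le_trans ?_ (normX_nonneg θ f)
        simpa [hj, mulConj_zero_left] using
          normX_mulConj_le (zero_mem (K θ)) (zero_mem (K θ))

/-! ### The analytic analog -/

theorem unimodMul_mulConj {φ : UnitAddCircle → ℂ} (hφ : IsUnimodular φ) (x y : L2) :
    unimodMul 1 hφ (mulConj x y) = mul x (unimodConj hφ y) := by
  apply Lp.ext
  filter_upwards [coeFn_unimodMul 1 hφ (mulConj x y), coeFn_mulConj x y,
    coeFn_mul x (unimodConj hφ y), coeFn_unimodConj hφ y] with t h₁ h₂ h₃ h₄
  rw [h₁, h₂, h₃, h₄]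
  ring

theorem unimodMul_conj_mul {φ : UnitAddCircle → ℂ} (hφ : IsUnimodular φ) (x y : L2) :
    unimodMul 1 hφ.conj (mul x y) = mulConj x (unimodConj hφ y) := by
  apply Lp.ext
  filter_upwards [coeFn_unimodMul 1 hφ.conj (mul x y), coeFn_mul x y,
    coeFn_mulConj x (unimodConj hφ y), coeFn_unimodConj hφ y] with t h₁ h₂ h₃ h₄
  rw [h₁, h₂, h₃, h₄, map_mul, Complex.conj_conj]
  ring

theorem unimodMul_unimodMul_conj {φ : UnitAddCircle → ℂ} (hφ : IsUnimodular φ) (f : L1) :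
    unimodMul 1 hφ (unimodMul 1 hφ.conj f) = f := by
  apply Lp.ext
  filter_upwards [coeFn_unimodMul 1 hφ (unimodMul 1 hφ.conj f), coeFn_unimodMul 1 hφ.conj f,
    hφ.conj_mul_self] with t h₁ h₂ h₃
  rw [h₁, h₂]
  linear_combination f t * h₃

theorem Represents.map {θ : ℂ → ℂ} (hφ : IsUnimodular (phase θ)) {B B' : L2 → L2 → L1}
    {T : L1 →ₗᵢ[ℂ] L1} (hT : ∀ x y, T (B x y) = B' x (unimodConj hφ y)) {x y : ℕ → L2} {f : L1}
    (h : Represents θ B x y f) :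
    Represents θ B' x (fun k => unimodConj hφ (y k)) (T f) where
  left_mem := h.left_mem
  right_mem k := unimodConj_mem_K hφ (h.right_mem k)
  summable := by simpa only [norm_unimodConj] using h.summable
  hasSum := by
    simp only [← hT]
    exact h.hasSum.mapL T.toContinuousLinearMap

/-- An isometry of `L¹` that turns the product `B x y` into `B' x (φ ȳ)` does not increase the
series norm. -/
theorem seriesNorm_map_le {θ : ℂ → ℂ} (hφ : IsUnimodular (phase θ)) {B B' : L2 → L2 → L1}
    {T : L1 →ₗᵢ[ℂ] L1} (hT : ∀ x y, T (B x y) = B' x (unimodConj hφ y)) {f : L1}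
    (hf : f ∈ seriesSpace θ B) : seriesNorm θ B' (T f) ≤ seriesNorm θ B f := by
  obtain ⟨x, y, h⟩ := hf
  refine le_csInf ⟨_, x, y, h, rfl⟩ ?_
  rintro _ ⟨x, y, h, rfl⟩
  simpa only [norm_unimodConj] using seriesNorm_le (h.map hφ hT)

theorem exists_four_mul {θ : ℂ → ℂ} (hφ : IsUnimodular (phase θ)) {f : L1} (hf : f ∈ Xa θ) :
    ∃ x y : Fin 4 → L2, (∀ j, x j ∈ K θ ∧ y j ∈ K θ) ∧ f = ∑ j, mul (x j) (y j) ∧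
      ∀ j, normXa θ (mul (x j) (y j)) ≤ normXa θ f := by
  have hF : unimodMul 1 hφ.conj f ∈ X θ := by
    obtain ⟨x, y, h⟩ := hf
    exact ⟨_, _, h.map hφ (unimodMul_conj_mul hφ)⟩
  obtain ⟨x, y, hxy, hsum, hnorm⟩ := exists_four_mulConj hφ hF
  refine ⟨x, fun j => unimodConj hφ (y j),
    fun j => ⟨(hxy j).1, unimodConj_mem_K hφ (hxy j).2⟩, ?_, fun j => ?_⟩
  · rw [← unimodMul_unimodMul_conj hφ f, hsum, map_sum]
    simp only [unimodMul_mulConj]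
  · rw [← unimodMul_mulConj]
    exact (seriesNorm_map_le hφ (unimodMul_mulConj hφ)
      ⟨_, _, represents_single (hxy j).1 (hxy j).2⟩).trans
      ((hnorm j).trans (seriesNorm_map_le hφ (unimodMul_conj_mul hφ) hf))

end ModelSpace

end

theorem proposition4p1 (θ : ℂ → ℂ) (hθ : ModelSpace.IsInner θ) :
    (∀ f ∈ ModelSpace.X θ, ModelSpace.Nonneg f →
      ∃ g ∈ ModelSpace.K θ, ∀ᵐ t ∂ModelSpace.m, f t = ((‖g t‖ ^ 2 : ℝ) : ℂ)) ∧
    (∀ f ∈ ModelSpace.X θ, ∃ (c : Fin 4 → ℂ) (h : Fin 4 → ModelSpace.L1),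
      (∀ j, h j ∈ ModelSpace.X θ ∧ ModelSpace.Nonneg (h j)) ∧ f = ∑ j, c j • h j) ∧
    (∀ f ∈ ModelSpace.X θ, ∃ x y : Fin 4 → ModelSpace.L2,
      (∀ j, x j ∈ ModelSpace.K θ ∧ y j ∈ ModelSpace.K θ) ∧
      f = ∑ j, ModelSpace.mulConj (x j) (y j) ∧
      ∀ j, ModelSpace.normX θ (ModelSpace.mulConj (x j) (y j)) ≤ ModelSpace.normX θ f) ∧
    (∀ f ∈ ModelSpace.Xa θ, ∃ x y : Fin 4 → ModelSpace.L2,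
      (∀ j, x j ∈ ModelSpace.K θ ∧ y j ∈ ModelSpace.K θ) ∧
      f = ∑ j, ModelSpace.mul (x j) (y j) ∧
      ∀ j, ModelSpace.normXa θ (ModelSpace.mul (x j) (y j)) ≤ ModelSpace.normXa θ f) := by
  have hφ := hθ.isUnimodular_phase
  refine ⟨fun f hf hf0 => ModelSpace.exists_eq_norm_sq_of_mem_X hφ hf hf0, ?_,
    fun f hf => ModelSpace.exists_four_mulConj hφ hf,
    fun f hf => ModelSpace.exists_four_mul hφ hf⟩
  rintro f ⟨x, y, hr⟩
  obtain ⟨h, hh, hf, -⟩ := ModelSpace.exists_four_nonneg hr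
  exact ⟨_, h, hh, hf⟩
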